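/- Let $p$ be a prime, $t\ge 1$, $q=p^t$ and $n\ge 2$. A design is a pair consisting of a finite set of points and a finite family of blocks (subsets of the point set); its $p$-rank is the rank over $GF(p)$ of its point-by-block incidence matrix. For a block $B$ of a design $\mathcal D$, the residual design $\mathcal D_B$ has as points the points of $\mathcal D$ not in $B$ and as blocks the sets $B'\setminus B$, where $B'$ runs over the other blocks of $\mathcal D$. A symmetric $2$-$(v,k,\lambda)$ design, $v\ge k\ge 2$, is a design with $v$ points and $v$ blocks, all blocks having size $k$, in which every two distinct points lie in exactly $\lambda$ common blocks. A linear embedding over $GF(p)$ of a design $\mathcal R$ in a symmetric $2$-design $\mathcal D$ consists of a block $B$ of $\mathcal D$ with $\operatorname{rank}_p\mathcal D=\operatorname{rank}_p\mathcal D_B+1$ together with an isomorphism $\mathcal R\to\mathcal D_B$. Let $AG_{n-1}(n,q)$ and $PG_{n-1}(n,q)$ denote the designs of points and hyperplanes of the $n$-dimensional affine, respectively projective, geometry over $GF(q)$. **Theorem.** The classical affine design $AG_{n-1}(n,q)$ admits a unique linear embedding over $GF(p)$, namely in $PG_{n-1}(n,q)$. Precisely: 1. $PG_{n-1}(n,q)$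 is a symmetric $2$-$\left(\frac{q^{n+1}-1}{q-1},\frac{q^n-1}{q-1},\frac{q^{n-1}-1}{q-1}\right)$ design, and for every block $H$ of it, the residual design $PG_{n-1}(n,q)_H$ is isomorphic to $AG_{n-1}(n,q)$ and $\operatorname{rank}_p PG_{n-1}(n,q)=\operatorname{rank}_p PG_{n-1}(n,q)_H+1$. 2. Let $\mathcal D$ be any symmetric $2$-design with a block $B$ such that $\operatorname{rank}_p\mathcal D=\operatorname{rank}_p\mathcal D_B+1$, and let $e\colon AG_{n-1}(n,q)\to\mathcal D_B$ be an isomorphism. Then $\mathcal D$ is isomorphic to $PG_{n-1}(n,q)$; moreover, for every hyperplane $H$ of $PG(n,q)$ and every isomorphism $e_0\colon AG_{n-1}(n,q)\to PG_{n-1}(n,q)_H$ there is an isomorphism $\varphi\colon\mathcal D\to PG_{n-1}(n,q)$ that maps $B$ to $H$ and satisfies $\varphi\circ e=e_0$ on points and on blocks. -/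

import Mathlib

/-- A design (incidence structure): a family of subsets of the point type `P`, called blocks,
indexed by `B`. Repeated blocks are allowed. -/
structure IncidenceStructure (P B : Type*) where
  /-- the set of points of the block with label `b` -/
  block : B → Set P

namespace IncidenceStructure

/-- The point-by-block incidence matrix with entries `0`, `1` in `R`. -/
noncomputable def incMatrix {P B : Type*} (D : IncidenceStructure P B) (R : Type*) [Zero R]
    [One R] : Matrix P B R :=
  open Classical in Matrix.of fun x b => if x ∈ D.block b then 1 else 0

/-- The `p`-rank: the rank over `GF(p)` of the incidence matrix. -/
noncomputable def pRank {P B : Type*} [Finite B] (D : IncidenceStructure P B) (p : ℕ) : ℕ :=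
  letI : Fintype B := Fintype.ofFinite B
  (D.incMatrix (ZMod p)).rank

/-- `t`-`(v,k,l)` designs: `v ≥ k ≥ t`, there are `v` points, all blocks have size `k`, and every
`t`-subset of points is contained in exactly `l` blocks. -/
structure IsDesign {P B : Type*} [Finite P] [Finite B] (D : IncidenceStructure P B)
    (t v k l : ℕ) : Prop where
  strength_le : t ≤ k
  size_le : k ≤ v
  card_points : Nat.card P = v
  card_block : ∀ b, (D.block b).ncard = k
  card_blocks_through : ∀ T : Finset P, T.card = t → {b | (T : Set P) ⊆ D.block b}.ncard = l

/-- Symmetric `2`-`(v,k,l)` designs: `2`-designs with as many blocks as points. -/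
structure IsSymmetricDesign {P B : Type*} [Finite P] [Finite B] (D : IncidenceStructure P B)
    (v k l : ℕ) : Prop extends D.IsDesign 2 v k l where
  card_blocks : Nat.card B = v

/-- The residual design with respect to the block `b`: delete the block `b` and all its points. -/
def residual {P B : Type*} (D : IncidenceStructure P B) (b : B) :
    IncidenceStructure {x : P // x ∉ D.block b} {c : B // c ≠ b} where
  block c := {x | x.1 ∈ D.block c.1}

/-- The residual design with respect to `b` is linearly embeddable over `GF(p)` (in `D`):
the `p`-ranks of `D` and of the residual design differ by one. -/
def LinearlyEmbeddable {P B : Type*} [Finite B] (D : IncidenceStructure P B) (p : ℕ)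
    (b : B) : Prop :=
  D.pRank p = (D.residual b).pRank p + 1

/-- Isomorphisms of designs. -/
structure Iso {P B P' B' : Type*} (D : IncidenceStructure P B)
    (E : IncidenceStructure P' B') where
  /-- the bijection between the points -/
  onPoints : P ≃ P'
  /-- the bijection between the blocks -/
  onBlocks : B ≃ B'
  mem_iff : ∀ x b, x ∈ D.block b ↔ onPoints x ∈ E.block (onBlocks b)

end IncidenceStructure

/-- The `d`-dimensional subspaces of the projective geometry `PG(n,F)`: the linear subspaces of
`F^(n+1)` of dimension `d+1`. -/
abbrev ProjSubspace (d n : ℕ) (F : Type*) [Field F] : Type _ :=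
  {W : Submodule F (Fin (n + 1) → F) // Module.finrank F W = d + 1}

/-- The design `PG_d(n,F)` of points and `d`-dimensional subspaces of `PG(n,F)`. -/
def projDesign (d n : ℕ) (F : Type*) [Field F] :
    IncidenceStructure (Projectivization F (Fin (n + 1) → F)) (ProjSubspace d n F) where
  block W := {x | x.submodule ≤ W.1}

/-- The `d`-dimensional subspaces of the affine geometry `AG(n,F)`. -/
abbrev AffSubspace (d n : ℕ) (F : Type*) [Field F] : Type _ :=
  {S : AffineSubspace F (Fin n → F) //
    (S : Set (Fin n → F)).Nonempty ∧ Module.finrank F S.direction = d}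

/-- The design `AG_d(n,F)` of points and `d`-dimensional subspaces of `AG(n,F)`. -/
def affDesign (d n : ℕ) (F : Type*) [Field F] :
    IncidenceStructure (Fin n → F) (AffSubspace d n F) where
  block S := (S.1 : Set (Fin n → F))

/-! Write q for the order of `F`. The residual design leaves open only which points of `b` lie on
which extended affine hyperplanes; linear embeddability forces the projective answer.

Two distinct blocks of a symmetric design meet in l points (`IsSymmetricDesign.ncard_inter`), so
parallel hyperplanes have the same trace on `b`. Take the q+1 hyperplanes of a pencil and let N(y)
count their extensions through y. The sum of these blocks minus the sum of a parallel class vanishes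
mod p off `b`, so by `linearlyEmbeddable_iff` it is constant on `b`. Hence N is constant mod p on
`b`, and counting shows the constant to be 1. Thus 1 ≤ N ≤ q+1 on `b`, while the first two moments
give ∑ (N-1)(q+1-N) = 0 over `b`: N is 1 or q+1 (`sum_pencil_chi_eq`).

So the functionals whose zero hyperplane extends through a given x in `b` form a hyperplane of the
dual space, that is, a point at infinity. Separation by blocks and a count make this assignment
bijective (`pointAtInfinity_bijective`). The same description holds for PG, and the two designs are
glued along it (`exists_iso_of_residual`).

PG itself is a linear embedding because a hyperplane meets each line in 1 mod p points, so every
codeword has equal sums over all lines. If it is supported on H, its value at a point of H is its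
sum over the line joining that point to a fixed point off H. -/

namespace IncidenceStructure

variable {P B : Type*}

/-! ### Counting in symmetric designs -/

section Counting

/-- The `0`-`1` indicator of incidence with values in `ℤ`. -/
noncomputable def chi (D : IncidenceStructure P B) (c : B) (x : P) : ℤ :=
  open Classical in if x ∈ D.block c then 1 else 0

theorem chi_of_mem {D : IncidenceStructure P B} {c : B} {x : P} (h : x ∈ D.block c) :
    D.chi c x = 1 := if_pos h

theorem chi_of_notMem {D : IncidenceStructure P B} {c : B} {x : P} (h : x ∉ D.block c) :
    D.chi c x = 0 := if_neg h

theorem chi_mul_self (D : IncidenceStructure P B) (c : B) (x : P) :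
    D.chi c x * D.chi c x = D.chi c x := by
  unfold chi; split_ifs <;> rfl

theorem sum_chi [Fintype P] (D : IncidenceStructure P B) (c : B) :
    ∑ x, D.chi c x = (D.block c).ncard := by
  classical
  simp only [chi, Finset.sum_boole]
  rw [Set.ncard_eq_toFinset_card']
  congr 2
  ext; simp

theorem sum_chi_mul_chi [Fintype P] (D : IncidenceStructure P B) (c c' : B) :
    ∑ x, D.chi c x * D.chi c' x = (D.block c ∩ D.block c').ncard := by
  classical
  simp only [chi, ← ite_and, mul_ite, mul_one, mul_zero, Finset.sum_boole]
  rw [Set.ncard_eq_toFinset_card']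
  congr 2
  ext; simp [and_comm]

variable [Fintype P] [Fintype B] {D : IncidenceStructure P B} {v k l : ℕ}

theorem IsDesign.sum_chi_block (h : D.IsDesign 2 v k l) (c : B) : ∑ x, D.chi c x = k := by
  rw [sum_chi, h.card_block]

theorem IsDesign.sum_chi_pair (h : D.IsDesign 2 v k l) {x y : P} (hxy : x ≠ y) :
    ∑ c, D.chi c x * D.chi c y = l := by
  classical
  rw [← h.card_blocks_through {x, y} (Finset.card_pair hxy)]
  simp only [chi, ← ite_and, mul_ite, mul_one, mul_zero, Finset.sum_boole]
  rw [Set.ncard_eq_toFinset_card']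
  congr 2
  ext; simp [Set.insert_subset_iff, and_comm]

theorem IsDesign.sum_chi_point (h : D.IsDesign 2 v k l) (x : P) :
    (∑ c, D.chi c x) * (k - 1) = l * (v - 1) := by
  classical
  have h1 : ∑ y, ∑ c, D.chi c x * D.chi c y = (∑ c, D.chi c x) * k := by
    rw [Finset.sum_comm, Finset.sum_mul]
    exact Finset.sum_congr rfl fun c _ => by rw [← Finset.mul_sum, h.sum_chi_block]
  have h2 : ∑ y, ∑ c, D.chi c x * D.chi c y = (∑ c, D.chi c x) + (v - 1) * l := by
    rw [← Finset.add_sum_erase _ _ (Finset.mem_univ x)]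
    congr 1
    · exact Finset.sum_congr rfl fun c _ => D.chi_mul_self c x
    · rw [Finset.sum_congr rfl fun y hy => h.sum_chi_pair (Finset.ne_of_mem_erase hy).symm,
        Finset.sum_const, Finset.card_erase_of_mem (Finset.mem_univ x), Finset.card_univ,
        ← Nat.card_eq_fintype_card, h.card_points, nsmul_eq_mul, Nat.cast_sub, Nat.cast_one]
      exact le_trans (le_trans one_le_two h.strength_le) h.size_le
  linarith

/-- The number of blocks through a point is constant; counting flags, with equally many points and
blocks, identifies it with the block size. -/
theorem IsSymmetricDesign.sum_chi_point (h : D.IsSymmetricDesign v k l) (x : P) :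
    ∑ c, D.chi c x = k := by
  have hk : (2 : ℤ) ≤ k := by exact_mod_cast h.strength_le
  have hv : (2 : ℤ) ≤ v := hk.trans (by exact_mod_cast h.size_le)
  have hconst : ∀ y, ∑ c, D.chi c y = ∑ c, D.chi c x := fun y =>
    mul_right_cancel₀ (b := (k : ℤ) - 1) (by omega)
      (by rw [h.toIsDesign.sum_chi_point, h.toIsDesign.sum_chi_point])
  have h1 : ∑ y, ∑ c, D.chi c y = v * ∑ c, D.chi c x := by
    rw [Finset.sum_congr rfl fun y _ => hconst y, Finset.sum_const, Finset.card_univ,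
      ← Nat.card_eq_fintype_card, h.card_points, nsmul_eq_mul]
  rw [Finset.sum_comm, Finset.sum_congr rfl fun c _ => h.toIsDesign.sum_chi_block c,
    Finset.sum_const, Finset.card_univ, ← Nat.card_eq_fintype_card, h.card_blocks,
    nsmul_eq_mul] at h1
  exact (mul_left_cancel₀ (by omega) h1).symm

theorem IsSymmetricDesign.param_eq (h : D.IsSymmetricDesign v k l) :
    (k : ℤ) * (k - 1) = l * (v - 1) := by
  have hv : 0 < Nat.card P := by
    rw [h.card_points]; exact lt_of_lt_of_le two_pos (h.strength_le.trans h.size_le)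
  obtain ⟨x⟩ := (Nat.card_pos_iff.1 hv).1
  rw [← h.toIsDesign.sum_chi_point x, h.sum_chi_point x]

/-- Two distinct blocks of a symmetric `2`-`(v,k,l)` design meet in `l` points. -/
theorem IsSymmetricDesign.ncard_inter (h : D.IsSymmetricDesign v k l) {c c' : B} (hc : c ≠ c') :
    (D.block c ∩ D.block c').ncard = l := by
  classical
  set m : B → ℤ := fun d => ∑ x, D.chi c x * D.chi d x with hm
  have hmc : m c = k := by
    simp only [hm, chi_mul_self]; exact h.toIsDesign.sum_chi_block c
  have h1 : ∑ d, m d = k * k := by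
    simp only [hm]
    rw [Finset.sum_comm]
    simp only [← Finset.mul_sum, h.sum_chi_point, ← Finset.sum_mul, h.toIsDesign.sum_chi_block]
  have h2 : ∑ d, m d * m d = k * k + k * (k - 1) * l := by
    have e1 : ∀ d, m d * m d =
        ∑ x, ∑ y, D.chi c x * D.chi c y * (D.chi d x * D.chi d y) := by
      intro d
      simp only [hm, Finset.sum_mul_sum]
      exact Finset.sum_congr rfl fun x _ => Finset.sum_congr rfl fun y _ => by ring
    have e2 : ∀ x y, ∑ d, D.chi d x * D.chi d y = l + if x = y then (k - l : ℤ) else 0 := by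
      intro x y
      split_ifs with hxy
      · subst hxy; simp only [chi_mul_self, h.sum_chi_point]; ring
      · rw [h.toIsDesign.sum_chi_pair hxy, add_zero]
    simp only [e1]
    rw [Finset.sum_comm]
    have e3 : ∀ x, ∑ d, ∑ y, D.chi c x * D.chi c y * (D.chi d x * D.chi d y) =
        D.chi c x * (k * l) + D.chi c x * (k - l) := by
      intro x
      rw [Finset.sum_comm]
      simp only [← Finset.mul_sum, e2, mul_add, Finset.sum_add_distrib, mul_ite, mul_zero,
        Finset.sum_ite_eq, Finset.mem_univ, if_true, chi_mul_self]
      rw [← Finset.sum_mul, ← Finset.mul_sum, h.toIsDesign.sum_chi_block]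
      ring
    simp only [e3, Finset.sum_add_distrib, ← Finset.sum_mul, h.toIsDesign.sum_chi_block]
    ring
  -- Variance argument: the first two moments of `m`, with `param_eq`, leave no deviation from l on
  -- the blocks other than `c`.
  have h3 : ∑ d ∈ Finset.univ.erase c, (m d - l) ^ 2 = 0 := by
    have := Finset.add_sum_erase Finset.univ (fun d => (m d - l) ^ 2) (Finset.mem_univ c)
    have e : ∑ d, (m d - l) ^ 2 = k * k + k * (k - 1) * l - 2 * l * (k * k) + v * l ^ 2 := by
      have : ∀ d, (m d - l) ^ 2 = m d * m d - 2 * l * m d + l ^ 2 := fun d => by ring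
      simp only [this, Finset.sum_add_distrib, Finset.sum_sub_distrib, ← Finset.mul_sum, h1, h2,
        Finset.sum_const, Finset.card_univ, ← Nat.card_eq_fintype_card, h.card_blocks,
        nsmul_eq_mul]
    rw [e, hmc] at this
    linear_combination this + (-l : ℤ) * h.param_eq
  have h4 := (Finset.sum_eq_zero_iff_of_nonneg fun d _ => sq_nonneg _).1 h3 c'
    (Finset.mem_erase.2 ⟨hc.symm, Finset.mem_univ _⟩)
  have h5 : m c' = l := by
    have := pow_eq_zero_iff two_ne_zero |>.1 h4; linarith
  rw [hm] at h5
  simp only [sum_chi_mul_chi] at h5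
  exact_mod_cast h5

/-- If `l < k`, then the points of a symmetric `2`-`(v,k,l)` design are separated by blocks. -/
theorem IsSymmetricDesign.exists_block (h : D.IsSymmetricDesign v k l) (hlk : l < k) {x y : P}
    (hxy : x ≠ y) : ∃ c, x ∉ D.block c ∧ y ∈ D.block c := by
  -- Otherwise every block through y contains x, and the pair lies on as many blocks as y does, so l
  -- = k.
  by_contra! hno
  have h1 : ∀ c, D.chi c x * D.chi c y = D.chi c y := by
    intro c
    by_cases hx : x ∈ D.block c
    · rw [chi_of_mem hx, one_mul]
    · rw [chi_of_notMem hx, chi_of_notMem (hno c hx), zero_mul]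
  have h2 := h.toIsDesign.sum_chi_pair hxy
  simp only [h1, h.sum_chi_point] at h2
  omega

end Counting

/-! ### Codes and linear embeddability -/

section Rank

variable {p : ℕ}

/-- The code of a design: the span of its blocks over `GF(p)`. -/
noncomputable def code (D : IncidenceStructure P B) (p : ℕ) : Submodule (ZMod p) (P → ZMod p) :=
  Submodule.span (ZMod p) (Set.range (D.incMatrix (ZMod p)).col)

theorem pRank_eq_finrank_code [Finite B] [Fact p.Prime] (D : IncidenceStructure P B) :
    D.pRank p = Module.finrank (ZMod p) (D.code p) := by
  let : Fintype B := Fintype.ofFinite B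
  exact Matrix.rank_eq_finrank_span_cols _

theorem incMatrix_apply_of_mem {D : IncidenceStructure P B} {R : Type*} [Zero R] [One R] {x : P}
    {c : B} (h : x ∈ D.block c) : D.incMatrix R x c = 1 := if_pos h

theorem incMatrix_apply_of_notMem {D : IncidenceStructure P B} {R : Type*} [Zero R] [One R]
    {x : P} {c : B} (h : x ∉ D.block c) : D.incMatrix R x c = 0 := if_neg h

theorem col_mem_code (D : IncidenceStructure P B) (c : B) :
    (D.incMatrix (ZMod p)).col c ∈ D.code p := Submodule.subset_span ⟨c, rfl⟩

/-- Restricted to the complement of `b`, column `b` vanishes and the other columns become those of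
the residual design. The rank drop is therefore the dimension of the kernel of restriction. -/
theorem map_code (D : IncidenceStructure P B) (b : B) :
    (D.code p).map (LinearMap.funLeft (ZMod p) (ZMod p)
      (Subtype.val : {x // x ∉ D.block b} → P)) = (D.residual b).code p := by
  rw [code, Submodule.map_span]
  apply le_antisymm
  · rw [Submodule.span_le]
    rintro _ ⟨_, ⟨c, rfl⟩, rfl⟩
    by_cases hc : c = b
    · subst hc
      have h0 : LinearMap.funLeft (ZMod p) (ZMod p) (Subtype.val : {x // x ∉ D.block c} → P)
          ((D.incMatrix (ZMod p)).col c) = 0 := funext fun x => incMatrix_apply_of_notMem x.2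
      rw [SetLike.mem_coe, h0]
      exact Submodule.zero_mem _
    · exact (D.residual b).col_mem_code ⟨c, hc⟩
  · rw [code, Submodule.span_le]
    rintro _ ⟨c, rfl⟩
    exact Submodule.subset_span ⟨_, ⟨c.1, rfl⟩, rfl⟩

/-- The residual design at a nonempty block is linearly embeddable if and only if the only
codewords supported on that block are the multiples of its indicator. -/
theorem linearlyEmbeddable_iff [Finite P] [Finite B] [Fact p.Prime] (D : IncidenceStructure P B) {b : B} (hb : (D.block b).Nonempty) :
    D.LinearlyEmbeddable p b ↔ ∀ w ∈ D.code p, (∀ x, x ∉ D.block b → w x = 0) →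
      ∃ a : ZMod p, ∀ x ∈ D.block b, w x = a := by
  set R := LinearMap.funLeft (ZMod p) (ZMod p) (Subtype.val : {x // x ∉ D.block b} → P) with hR
  set f := R.domRestrict (D.code p) with hf
  have hker : ∀ w : D.code p, w ∈ LinearMap.ker f ↔ ∀ x, x ∉ D.block b → w.1 x = 0 := by
    intro w
    rw [LinearMap.mem_ker, funext_iff]
    exact ⟨fun h x hx => h ⟨x, hx⟩, fun h x => h x.1 x.2⟩
  have hfin := LinearMap.finrank_range_add_finrank_ker f
  rw [LinearMap.range_domRestrict, map_code, ← pRank_eq_finrank_code,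
    ← pRank_eq_finrank_code] at hfin
  have h1 : D.LinearlyEmbeddable p b ↔ Module.finrank (ZMod p) (LinearMap.ker f) = 1 := by
    unfold LinearlyEmbeddable; omega
  -- The indicator of `b` is always in the kernel, so a one-dimensional kernel consists of its
  -- multiples.
  let u : LinearMap.ker f := ⟨⟨_, D.col_mem_code b⟩, (hker _).2 fun x hx =>
    incMatrix_apply_of_notMem hx⟩
  have hu1 : ∀ x ∈ D.block b, u.1.1 x = 1 := fun x hx => incMatrix_apply_of_mem hx
  have hu0 : u ≠ 0 := by
    intro h
    obtain ⟨x, hx⟩ := hb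
    have := hu1 x hx
    rw [h] at this
    exact zero_ne_one this
  rw [h1, finrank_eq_one_iff_of_nonzero' u hu0]
  constructor
  · intro h w hw hwb
    obtain ⟨a, ha⟩ := h ⟨⟨w, hw⟩, (hker _).2 hwb⟩
    refine ⟨a, fun x hx => ?_⟩
    have := congrArg (fun z : LinearMap.ker f => z.1.1 x) ha
    simpa [hu1 x hx] using this.symm
  · intro h w
    obtain ⟨a, ha⟩ := h w.1.1 w.1.2 ((hker _).1 w.2)
    refine ⟨a, Subtype.ext (Subtype.ext (funext fun x => ?_))⟩
    by_cases hx : x ∈ D.block b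
    · simp [hu1 x hx, ha x hx]
    · have := (hker _).1 w.2 x hx
      have h' := (hker _).1 u.2 x hx
      simp [this, h']

end Rank

end IncidenceStructure

/-! ### Pencils of vectors and functionals -/

section Pencil

variable {F M N : Type*} [Field F] [AddCommGroup M] [Module F M] [AddCommGroup N] [Module F N]

/-- Representatives of the points of the projective line through the points spanned by
`f` and `g`. -/
def pencil (f g : M) : Option F → M
  | none => f
  | some c => g + c • f

theorem map_pencil (h : M →ₗ[F] N) (f g : M) (i : Option F) :
    h (pencil f g i) = pencil (h f) (h g) i := by
  cases i <;> simp [pencil]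

theorem pencil_apply (f g : Module.Dual F M) (v : M) (i : Option F) :
    pencil f g i v = pencil (f v) (g v) i := by
  cases i <;> simp [pencil]

/-- Any two distinct members of a pencil cut out its base. -/
theorem pencil_eq_zero_and (a b : F) {i j : Option F} (hij : i ≠ j) :
    (pencil a b i = 0 ∧ pencil a b j = 0) ↔ (a = 0 ∧ b = 0) := by
  constructor
  · rcases i with _ | c <;> rcases j with _ | d
    · exact absurd rfl hij
    · rintro ⟨h1, h2⟩
      simp only [pencil, smul_eq_mul] at h1 h2
      subst h1
      simpa using h2
    · rintro ⟨h1, h2⟩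
      simp only [pencil, smul_eq_mul] at h1 h2
      subst h2
      simpa using h1
    · rintro ⟨h1, h2⟩
      simp only [pencil, smul_eq_mul] at h1 h2
      have hcd : c - d ≠ 0 := sub_ne_zero.2 fun h => hij (by rw [h])
      have ha : a = 0 := by
        apply (mul_eq_zero.1 (_ : (c - d) * a = 0)).resolve_left hcd
        linear_combination h1 - h2
      subst ha
      exact ⟨rfl, by simpa using h1⟩
  · rintro ⟨rfl, rfl⟩
    cases i <;> cases j <;> simp [pencil]

theorem pencil_ne_zero {f g : M} (hfg : LinearIndependent F ![f, g]) (i : Option F) :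
    pencil f g i ≠ 0 := by
  rw [LinearIndependent.pair_iff] at hfg
  rcases i with _ | c
  · intro h
    have := hfg 1 0 (by simpa [pencil] using h)
    exact one_ne_zero this.1
  · intro h
    have := hfg c 1 (by rw [one_smul, add_comm]; exact h)
    exact one_ne_zero this.2

/-- A hyperplane meets a projective line in one point or contains it; in both cases the number
of common points is `1` modulo the characteristic. -/
theorem sum_pencil [Fintype F] {R : Type*} [CommRing R] (hF : (Fintype.card F : R) = 0)
    [DecidableEq F] (a b : F) :
    ∑ i : Option F, (if pencil a b i = 0 then (1 : R) else 0) = 1 := by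
  rw [Fintype.sum_option]
  simp only [pencil, smul_eq_mul]
  by_cases ha : a = 0
  · subst ha
    by_cases hb : b = 0 <;> simp [hb, hF]
  · have h : ∀ c : F, (b + c * a = 0) ↔ c = -b / a := fun c => by
      rw [eq_div_iff ha, add_comm, add_eq_zero_iff_eq_neg]
    simp [ha, h]

end Pencil

/-! ### Hyperplanes as kernels of functionals -/

section Hyperplane

variable {F V : Type*} [Field F] [AddCommGroup V] [Module F V] [FiniteDimensional F V]

theorem exists_eq_ker_of_finrank {W : Submodule F V}
    (hW : Module.finrank F W + 1 = Module.finrank F V) :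
    ∃ h : Module.Dual F V, h ≠ 0 ∧ W = LinearMap.ker h := by
  obtain ⟨h, h0, hle⟩ := W.exists_le_ker_of_lt_top
    (Submodule.lt_top_of_finrank_lt_finrank (by omega))
  refine ⟨h, h0, Submodule.eq_of_le_of_finrank_eq hle ?_⟩
  have := Module.Dual.finrank_ker_add_one_of_ne_zero h0
  omega

theorem finrank_ker_inf_ker {f g : Module.Dual F V} (hfg : LinearIndependent F ![f, g]) :
    Module.finrank F (LinearMap.ker f ⊓ LinearMap.ker g : Submodule F V) + 2 =
      Module.finrank F V := by
  have h := Subspace.finrank_add_finrank_dualCoannihilator_eq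
    (Submodule.span F (Set.range ![f, g]))
  rw [finrank_span_eq_card hfg, Fintype.card_fin] at h
  have e : (Submodule.span F (Set.range ![f, g])).dualCoannihilator =
      LinearMap.ker f ⊓ LinearMap.ker g := by
    ext v
    rw [← SetLike.mem_coe, Submodule.coe_dualCoannihilator_span]
    simp [and_comm]
  rw [e] at h
  omega

end Hyperplane

/-! ### Projective space is a linear embedding -/

section ProjLinear

variable {F : Type*} [Field F] {n : ℕ}

theorem mk_mem_projDesign_block {d : ℕ} {W : ProjSubspace d n F} {v : Fin (n + 1) → F}
    (hv : v ≠ 0) : Projectivization.mk F v hv ∈ (projDesign d n F).block W ↔ v ∈ W.1 := by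
  change (Projectivization.mk F v hv).submodule ≤ W.1 ↔ _
  rw [Projectivization.submodule_mk, Submodule.span_singleton_le_iff_mem]

theorem ProjSubspace.exists_eq_ker (hn : 1 ≤ n) (H : ProjSubspace (n - 1) n F) :
    ∃ h : Module.Dual F (Fin (n + 1) → F), h ≠ 0 ∧ H.1 = LinearMap.ker h := by
  apply exists_eq_ker_of_finrank
  rw [H.2, Module.finrank_fin_fun]
  omega

/-- The sum of the entries of a codeword over a line. -/
theorem projDesign_sum_line [Fintype F] {p : ℕ} [Fact p.Prime]
    (hF : (Fintype.card F : ZMod p) = 0) (hn : 1 ≤ n)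
    {z u : Fin (n + 1) → F} (hzu : ∀ i, pencil (F := F) z u i ≠ 0)
    {z' u' : Fin (n + 1) → F} (hzu' : ∀ i, pencil (F := F) z' u' i ≠ 0)
    {w : Projectivization F (Fin (n + 1) → F) → ZMod p}
    (hw : w ∈ (projDesign (n - 1) n F).code p) :
    ∑ i, w (Projectivization.mk F _ (hzu i)) = ∑ i, w (Projectivization.mk F _ (hzu' i)) := by
  classical
  -- Each generator of the code has sum 1 over every line, so equality of line sums passes to the
  -- span.
  have key : ∀ (W : ProjSubspace (n - 1) n F) {z u : Fin (n + 1) → F}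
      (hzu : ∀ i, pencil (F := F) z u i ≠ 0),
      ∑ i, ((projDesign (n - 1) n F).incMatrix (ZMod p)).col W
        (Projectivization.mk F _ (hzu i)) = 1 := by
    intro W z u hzu
    obtain ⟨h, -, hW⟩ := W.exists_eq_ker hn
    rw [← sum_pencil hF (h z) (h u)]
    refine Finset.sum_congr rfl fun i _ => ?_
    simp only [← map_pencil, ← LinearMap.mem_ker, ← hW]
    rw [Matrix.col_apply]
    split_ifs with hi
    · exact IncidenceStructure.incMatrix_apply_of_mem ((mk_mem_projDesign_block _).2 hi)
    · exact IncidenceStructure.incMatrix_apply_of_notMem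
        (mt (mk_mem_projDesign_block _).1 hi)
  induction hw using Submodule.span_induction with
  | mem w hw =>
    obtain ⟨W, rfl⟩ := hw
    rw [key, key]
  | zero => simp
  | add w w' _ _ h h' => simp only [Pi.add_apply, Finset.sum_add_distrib, h, h']
  | smul a w _ h => simp only [Pi.smul_apply, ← Finset.smul_sum, h]

/-- For a codeword supported on H, a line through a fixed z off H and a point of H contributes only
the value at that point. Equal line sums make the codeword constant on H. -/
theorem projDesign_linearlyEmbeddable [Finite F] {p : ℕ} [Fact p.Prime]
    (hF : (Nat.card F : ZMod p) = 0) (hn : 1 ≤ n) (H : ProjSubspace (n - 1) n F) :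
    (projDesign (n - 1) n F).LinearlyEmbeddable p H := by
  classical
  let := Fintype.ofFinite F
  rw [Nat.card_eq_fintype_card] at hF
  obtain ⟨h, h0, hH⟩ := H.exists_eq_ker hn
  obtain ⟨z, hz⟩ : ∃ z, h z ≠ 0 := by
    by_contra! hcon
    exact h0 (LinearMap.ext hcon)
  have hne : ∀ u, u ≠ 0 → h u = 0 → ∀ i, pencil (F := F) z u i ≠ 0 := by
    intro u hu hu0 i hi
    have h1 := congrArg h hi
    rw [map_pencil, hu0, map_zero] at h1
    rcases i with _ | c
    · exact hz h1
    · have hc : c = 0 := by simpa [pencil, hz] using h1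
      subst hc
      exact hu (by simpa [pencil] using hi)
  obtain ⟨u₀, hu₀, hu₀0⟩ : ∃ u ∈ H.1, u ≠ 0 := by
    apply H.1.ne_bot_iff.1
    intro hbot
    have := H.2
    rw [hbot, finrank_bot] at this
    omega
  refine (IncidenceStructure.linearlyEmbeddable_iff _
    ⟨Projectivization.mk F u₀ hu₀0, (mk_mem_projDesign_block _).2 hu₀⟩).2 fun w hw hsupp =>
      ⟨w (Projectivization.mk F u₀ hu₀0), fun x hx => ?_⟩
  have key : ∀ u (hu : u ≠ 0) (hu0 : h u = 0),
      ∑ i, w (Projectivization.mk F _ (hne u hu hu0 i)) = w (Projectivization.mk F u hu) := by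
    intro u hu hu0
    -- The index `some 0` gives u itself; all other members of the pencil lie off H.
    rw [Finset.sum_eq_single (some (0 : F))]
    · congr 2
      simp [pencil]
    · intro i _ hi
      apply hsupp
      rw [mk_mem_projDesign_block, hH, LinearMap.mem_ker, map_pencil, hu0]
      rcases i with _ | c
      · exact hz
      · have hc : c ≠ 0 := fun hc => hi (by rw [hc])
        simp [pencil, hc, hz]
    · simp
  induction x using Projectivization.ind with
  | h u hu =>
    have hu0 : h u = 0 := by
      rwa [mk_mem_projDesign_block, hH] at hx
    have hu₀h : h u₀ = 0 := by rwa [hH] at hu₀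
    rw [← key u hu hu0, ← key u₀ hu₀0 hu₀h]
    exact projDesign_sum_line hF hn _ _ hw

end ProjLinear

/-! ### Counting points of subspaces -/

section Count

variable {F V : Type*} [Field F] [Finite F] [AddCommGroup V] [Module F V] [FiniteDimensional F V]

theorem natCard_projectivization :
    Nat.card (Projectivization F V) =
      (Nat.card F ^ Module.finrank F V - 1) / (Nat.card F - 1) := by
  rw [Projectivization.card'', Module.natCard_eq_pow_finrank (K := F)]

theorem ncard_submodule_le (A : Submodule F V) :
    {x : Projectivization F V | x.submodule ≤ A}.ncard =
      (Nat.card F ^ Module.finrank F A - 1) / (Nat.card F - 1) := by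
  rw [← natCard_projectivization, ← Set.ncard_univ,
    ← Set.ncard_image_of_injective _ (Projectivization.map_injective A.subtype A.injective_subtype)]
  congr 1
  ext x
  induction x using Projectivization.ind with
  | h v hv =>
    simp only [Set.mem_ofPred_eq, Projectivization.submodule_mk,
      Submodule.span_singleton_le_iff_mem, Set.image_univ, Set.mem_range]
    constructor
    · intro hA
      exact ⟨Projectivization.mk F ⟨v, hA⟩ (by simpa using hv), rfl⟩
    · rintro ⟨y, hy⟩
      induction y using Projectivization.ind with
      | h a ha =>
        rw [Projectivization.map_mk, Projectivization.mk_eq_mk_iff'] at hy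
        obtain ⟨c, hc⟩ := hy
        have : v = c⁻¹ • (a : V) := by
          have hc0 : c ≠ 0 := by
            rintro rfl
            rw [zero_smul] at hc
            exact ha (Subtype.ext hc.symm)
          rw [← A.subtype_apply, ← hc, smul_smul, inv_mul_cancel₀ hc0, one_smul]
        rw [this]
        exact A.smul_mem _ a.2

end Count

/-! ### Duality and the parameters of the projective design -/

section ProjDesign

variable {F : Type*} [Field F] {n : ℕ}

/-- The hyperplanes of `PG(n,F)` are the points of the dual space. -/
noncomputable def ProjSubspace.equivDual (hn : 1 ≤ n) :
    ProjSubspace (n - 1) n F ≃ Projectivization F (Module.Dual F (Fin (n + 1) → F)) where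
  toFun W := Projectivization.mk'' W.1.dualAnnihilator (by
    have := Subspace.finrank_add_finrank_dualAnnihilator_eq W.1
    rw [W.2, Module.finrank_fin_fun] at this
    omega)
  invFun x := ⟨x.submodule.dualCoannihilator, by
    have := Subspace.finrank_add_finrank_dualCoannihilator_eq x.submodule
    rw [x.finrank_submodule, Module.finrank_fin_fun] at this
    omega⟩
  left_inv W := by
    ext1
    simp [Subspace.dualAnnihilator_dualCoannihilator_eq]
  right_inv x := by
    apply Projectivization.submodule_injective
    simp [Subspace.dualCoannihilator_dualAnnihilator_eq]

/-- By duality, hyperplanes containing A are the projective points of its annihilator. -/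
theorem ncard_hyperplanes_ge [Finite F] (hn : 1 ≤ n) (A : Submodule F (Fin (n + 1) → F)) :
    {W : ProjSubspace (n - 1) n F | A ≤ W.1}.ncard =
      (Nat.card F ^ (n + 1 - Module.finrank F A) - 1) / (Nat.card F - 1) := by
  have h := Subspace.finrank_add_finrank_dualAnnihilator_eq A
  rw [Module.finrank_fin_fun] at h
  rw [show n + 1 - Module.finrank F A = Module.finrank F A.dualAnnihilator by omega,
    ← ncard_submodule_le,
    ← Set.ncard_image_of_injective _ (ProjSubspace.equivDual (F := F) hn).injective]
  congr 1
  ext x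
  constructor
  · rintro ⟨W, hW, rfl⟩
    simp only [ProjSubspace.equivDual, Equiv.coe_fn_mk, Set.mem_ofPred_eq,
      Projectivization.submodule_mk'']
    exact Submodule.dualAnnihilator_anti hW
  · intro hx
    refine ⟨(ProjSubspace.equivDual hn).symm x, ?_, Equiv.apply_symm_apply _ _⟩
    have := Submodule.dualCoannihilator_anti hx
    rwa [Subspace.dualAnnihilator_dualCoannihilator_eq] at this

theorem projDesign_isSymmetricDesign [Finite F] (hn : 2 ≤ n) :
    (projDesign (n - 1) n F).IsSymmetricDesign
      ((Nat.card F ^ (n + 1) - 1) / (Nat.card F - 1))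
      ((Nat.card F ^ n - 1) / (Nat.card F - 1))
      ((Nat.card F ^ (n - 1) - 1) / (Nat.card F - 1)) where
  strength_le := by
    have hq : 1 < Nat.card F := Finite.one_lt_card
    have h2 : Nat.card F ^ 2 ≤ Nat.card F ^ n := Nat.pow_le_pow_right (by omega) hn
    rw [Nat.le_div_iff_mul_le (by omega)]
    generalize Nat.card F = q at *
    obtain ⟨r, rfl⟩ : ∃ r, q = r + 2 := ⟨q - 2, by omega⟩
    have : (r + 2) ^ 2 = r * r + 4 * r + 4 := by ring
    have := Nat.zero_le (r * r)
    omega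
  size_le := by
    apply Nat.div_le_div_right
    apply Nat.sub_le_sub_right
    exact Nat.pow_le_pow_right Nat.card_pos (by omega)
  card_points := by
    rw [natCard_projectivization, Module.finrank_fin_fun]
  card_block W := by
    have := ncard_submodule_le W.1
    rw [show Module.finrank F W.1 = n by rw [W.2]; omega] at this
    exact this
  card_blocks_through T hT := by
    classical
    obtain ⟨x, y, hxy, rfl⟩ := Finset.card_eq_two.1 hT
    have hfin : Module.finrank F ↥(x.submodule ⊔ y.submodule) = 2 := by
      have hli := Projectivization.linearIndependent_pair_iff_ne.2 hxy
      have := finrank_span_eq_card hli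
      rw [Matrix.range_cons, Matrix.range_cons, Matrix.range_empty, Set.union_empty,
        Submodule.span_union, ← Projectivization.submodule_eq, ← Projectivization.submodule_eq,
        Fintype.card_fin] at this
      exact this
    have := ncard_hyperplanes_ge (by omega) (x.submodule ⊔ y.submodule)
    rw [hfin, show n + 1 - 2 = n - 1 by omega] at this
    rw [← this]
    congr 1
    ext W
    simp [Set.insert_subset_iff, projDesign]
  card_blocks := by
    have := ncard_hyperplanes_ge (F := F) (n := n) (by omega) ⊥
    rw [finrank_bot, Nat.sub_zero] at this
    rw [← this, ← Set.ncard_univ]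
    congr 1
    ext W
    simp

end ProjDesign

/-! ### Affine hyperplanes and residuals of projective space -/

section AffDesign

variable {F : Type*} [Field F] {n : ℕ}

/-- The affine hyperplane of all `v` with `f v = a`. -/
noncomputable def affHyp (hn : 1 ≤ n) (f : Module.Dual F (Fin n → F)) (hf : f ≠ 0) (a : F) :
    AffSubspace (n - 1) n F :=
  ⟨AffineSubspace.mk' (LinearMap.surjective hf a).choose (LinearMap.ker f),
    AffineSubspace.mk'_nonempty _ _, by
    rw [AffineSubspace.direction_mk']
    have := Module.Dual.finrank_ker_add_one_of_ne_zero hf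
    rw [Module.finrank_fin_fun] at this
    omega⟩

theorem mem_affHyp (hn : 1 ≤ n) {f : Module.Dual F (Fin n → F)} (hf : f ≠ 0) (a : F)
    (v : Fin n → F) : v ∈ (affDesign (n - 1) n F).block (affHyp hn f hf a) ↔ f v = a := by
  change v ∈ AffineSubspace.mk' _ _ ↔ _
  rw [AffineSubspace.mem_mk', LinearMap.mem_ker, vsub_eq_sub, map_sub,
    (LinearMap.surjective hf a).choose_spec, sub_eq_zero]

theorem direction_affHyp (hn : 1 ≤ n) {f : Module.Dual F (Fin n → F)} (hf : f ≠ 0) (a : F) :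
    (affHyp hn f hf a).1.direction = LinearMap.ker f := AffineSubspace.direction_mk' _ _

theorem affHyp_eq_of_forall_mem_iff (hn : 1 ≤ n) {f : Module.Dual F (Fin n → F)} (hf : f ≠ 0)
    (a : F) {S : AffSubspace (n - 1) n F} (h : ∀ v, v ∈ S.1 ↔ f v = a) :
    S = affHyp hn f hf a := by
  ext v
  exact (h v).trans (mem_affHyp hn hf a v).symm

theorem exists_eq_affHyp (hn : 1 ≤ n) (S : AffSubspace (n - 1) n F) :
    ∃ f, ∃ hf : f ≠ 0, ∃ a, S = affHyp hn f hf a := by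
  obtain ⟨f, hf, hS⟩ := exists_eq_ker_of_finrank (W := S.1.direction) (by
    rw [S.2.2, Module.finrank_fin_fun]; omega)
  obtain ⟨v₀, hv₀⟩ := S.2.1
  refine ⟨f, hf, f v₀, affHyp_eq_of_forall_mem_iff hn hf _ fun v => ?_⟩
  rw [← AffineSubspace.vsub_right_mem_direction_iff_mem hv₀, hS, LinearMap.mem_ker, vsub_eq_sub,
    map_sub, sub_eq_zero]

/-- The residual designs of `PG_{n-1}(n,F)` are isomorphic to `AG_{n-1}(n,F)`. -/
theorem nonempty_iso_residual_projDesign (hn : 1 ≤ n) (H : ProjSubspace (n - 1) n F) :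
    Nonempty ((affDesign (n - 1) n F).Iso ((projDesign (n - 1) n F).residual H)) := by
  obtain ⟨h, h0, hH⟩ := H.exists_eq_ker hn
  -- Affine chart: the points off H are represented by the vectors u + ε v on the slice h = 1.
  obtain ⟨u, hu⟩ := LinearMap.surjective h0 1
  have hfin : Module.finrank F (Fin n → F) = Module.finrank F H.1 := by
    rw [H.2, Module.finrank_fin_fun]; omega
  let ε : (Fin n → F) ≃ₗ[F] H.1 := LinearEquiv.ofFinrankEq _ _ hfin
  have memH : ∀ x, x ∈ H.1 ↔ h x = 0 := fun x => by rw [hH, LinearMap.mem_ker]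
  have hε : ∀ v, h (ε v) = 0 := fun v => (memH _).1 (ε v).2
  have hne : ∀ v, u + (ε v : Fin (n + 1) → F) ≠ 0 := fun v hv => by
    have := congrArg h hv
    simp [hu, hε] at this
  have hsub : ∀ x, x - h x • u ∈ H.1 := fun x => by simp [hH, hu]
  -- points
  let pt : (Fin n → F) → {x // x ∉ (projDesign (n - 1) n F).block H} := fun v =>
    ⟨Projectivization.mk F _ (hne v), by
      rw [mk_mem_projDesign_block, memH]; simp [hu, hε]⟩
  have hpt : Function.Bijective pt := by
    constructor
    · intro v v' hvv'
      have := Subtype.ext_iff.1 hvv'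
      rw [Projectivization.mk_eq_mk_iff'] at this
      obtain ⟨c, hc⟩ := this
      have h1 := congrArg h hc
      have hc1 : c = 1 := by simpa [hu, hε] using h1
      rw [hc1, one_smul] at hc
      exact ε.injective (Subtype.ext (add_left_cancel hc)).symm
    · rintro ⟨x, hx⟩
      induction x using Projectivization.ind with
      | h x hx0 =>
        have hhx : h x ≠ 0 := by
          rwa [mk_mem_projDesign_block, memH] at hx
        refine ⟨ε.symm ((h x)⁻¹ • ⟨x - h x • u, hsub x⟩), Subtype.ext ?_⟩
        change Projectivization.mk F _ _ = _
        rw [Projectivization.mk_eq_mk_iff']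
        refine ⟨(h x)⁻¹, ?_⟩
        simp [smul_sub, smul_smul, hhx]
  -- blocks
  have hbl : ∀ W : {W : ProjSubspace (n - 1) n F // W ≠ H}, ∃ S : AffSubspace (n - 1) n F,
      ∀ v, v ∈ S.1 ↔ u + (ε v : Fin (n + 1) → F) ∈ W.1.1 := by
    rintro ⟨W, hW⟩
    obtain ⟨g, -, hg⟩ := W.exists_eq_ker hn
    have hf : g ∘ₗ H.1.subtype ∘ₗ ε.toLinearMap ≠ 0 := by
      intro hf
      apply hW
      symm
      apply Subtype.ext
      refine Submodule.eq_of_le_of_finrank_eq (fun x hx => ?_) (by rw [H.2, W.2])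
      have := LinearMap.congr_fun hf (ε.symm ⟨x, hx⟩)
      rw [hg]
      simpa using this
    refine ⟨affHyp hn _ hf (-g u), fun v => (mem_affHyp hn hf _ v).trans ?_⟩
    rw [hg, LinearMap.mem_ker, map_add, add_comm (g u), add_eq_zero_iff_eq_neg]
    rfl
  choose bl hbl using hbl
  have hblb : Function.Bijective bl := by
    constructor
    · intro W W' hWW'
      have key : ∀ x, h x ≠ 0 → x ∈ W.1.1 → x ∈ W'.1.1 := by
        intro x hx hxW
        obtain ⟨v, hv⟩ := hpt.2 ⟨Projectivization.mk F x (fun h0 => hx (by rw [h0, map_zero])), by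
          rwa [mk_mem_projDesign_block, memH]⟩
        have hv := Subtype.ext_iff.1 hv
        change Projectivization.mk F _ (hne v) = _ at hv
        have hmem : ∀ W : ProjSubspace (n - 1) n F,
            u + (ε v : Fin (n + 1) → F) ∈ W.1 ↔ x ∈ W.1 := fun W => by
          rw [← mk_mem_projDesign_block (hne v), hv, mk_mem_projDesign_block]
        rw [← hmem, ← hbl, ← hWW', hbl, hmem]
        exact hxW
      -- Adding a vector of W off H moves the vectors of W ∩ H off H, where `key` applies.
      obtain ⟨x₀, hx₀, hx₀h⟩ : ∃ x ∈ W.1.1, h x ≠ 0 := by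
        by_contra! hcon
        apply W.2
        apply Subtype.ext
        refine Submodule.eq_of_le_of_finrank_eq (fun x hx => ?_) (by rw [H.2, W.1.2])
        rw [hH]
        exact hcon x hx
      apply Subtype.ext
      apply Subtype.ext
      refine Submodule.eq_of_le_of_finrank_eq (fun x hx => ?_) (by rw [W.1.2, W'.1.2])
      by_cases hxh : h x = 0
      · have h1 := key (x + x₀) (by simpa [hxh] using hx₀h) (add_mem hx hx₀)
        have := sub_mem h1 (key x₀ hx₀h hx₀)
        simpa using this
      · exact key x hxh hx
    · intro S
      obtain ⟨f, hf, a, rfl⟩ := exists_eq_affHyp hn S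
      -- π is the projection onto H along u; g below homogenises the affine equation f v = a.
      let π : (Fin (n + 1) → F) →ₗ[F] H.1 :=
        LinearMap.codRestrict H.1 (LinearMap.id - h.smulRight u) (fun x => by
          simpa using hsub x)
      have hπ : ∀ v, π (u + (ε v : Fin (n + 1) → F)) = ε v := fun v => Subtype.ext (by
        simp [π, hu, hε])
      have hπ' : ∀ v, π (ε v : Fin (n + 1) → F) = ε v := fun v => Subtype.ext (by
        simp [π, hε])
      let g : Module.Dual F (Fin (n + 1) → F) := f ∘ₗ ε.symm.toLinearMap ∘ₗ π - a • h
      have hg1 : ∀ v, g (u + (ε v : Fin (n + 1) → F)) = f v - a := fun v => by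
        have e : g (u + (ε v : Fin (n + 1) → F)) =
          f (ε.symm (π (u + (ε v : Fin (n + 1) → F)))) - a * h (u + (ε v : Fin (n + 1) → F)) := rfl
        rw [e, hπ, LinearEquiv.symm_apply_apply, map_add, hu, hε, add_zero, mul_one]
      have hg2 : ∀ v, g (ε v : Fin (n + 1) → F) = f v := fun v => by
        have e : g (ε v : Fin (n + 1) → F) =
          f (ε.symm (π (ε v : Fin (n + 1) → F))) - a * h (ε v : Fin (n + 1) → F) := rfl
        rw [e, hπ', LinearEquiv.symm_apply_apply, hε, mul_zero, sub_zero]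
      obtain ⟨v₁, hv₁⟩ := LinearMap.surjective hf 1
      have hg0 : g ≠ 0 := fun h0 => by
        have := hg2 v₁
        rw [h0, hv₁] at this
        exact zero_ne_one this
      refine ⟨⟨⟨LinearMap.ker g, ?_⟩, ?_⟩, ?_⟩
      · have := Module.Dual.finrank_ker_add_one_of_ne_zero hg0
        rw [Module.finrank_fin_fun] at this
        omega
      · intro hgH
        have h1 : (ε v₁ : Fin (n + 1) → F) ∈ LinearMap.ker g := by
          rw [show LinearMap.ker g = H.1 from Subtype.ext_iff.1 hgH]
          exact (ε v₁).2
        rw [LinearMap.mem_ker, hg2, hv₁] at h1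
        exact one_ne_zero h1
      · apply affHyp_eq_of_forall_mem_iff
        intro v
        rw [hbl, LinearMap.mem_ker, hg1, sub_eq_zero]
  refine ⟨⟨Equiv.ofBijective pt hpt, (Equiv.ofBijective bl hblb).symm, fun v S => ?_⟩⟩
  obtain ⟨W, rfl⟩ := hblb.2 S
  have e : (Equiv.ofBijective bl hblb).symm (bl W) = W :=
    (Equiv.ofBijective bl hblb).symm_apply_apply W
  rw [e]
  exact (hbl W v).trans (mk_mem_projDesign_block (hne v)).symm

end AffDesign

namespace IncidenceStructure

theorem incMatrix_eq_chi {P B : Type*} (D : IncidenceStructure P B) (R : Type*) [Ring R] (x : P)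
    (c : B) : D.incMatrix R x c = (D.chi c x : R) := by
  by_cases hx : x ∈ D.block c
  · rw [incMatrix_apply_of_mem hx, chi_of_mem hx, Int.cast_one]
  · rw [incMatrix_apply_of_notMem hx, chi_of_notMem hx, Int.cast_zero]

/-! ### Extending affine hyperplanes to blocks -/

section Embedding

variable {P B F : Type*} [Field F] {n : ℕ} {D : IncidenceStructure P B} {b : B}

theorem Iso.apply_mem_block_iff {P' B' : Type*} {E : IncidenceStructure P' B'}
    (e : E.Iso (D.residual b)) (x : P') (S : B') :
    (e.onPoints x).1 ∈ D.block (e.onBlocks S).1 ↔ x ∈ E.block S := (e.mem_iff x S).symm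

theorem Iso.ncard_diff {P' B' : Type*} {E : IncidenceStructure P' B'}
    (e : E.Iso (D.residual b)) (A : Set P) :
    (A \ D.block b).ncard = {x | (e.onPoints x).1 ∈ A}.ncard := by
  rw [← Set.ncard_image_of_injective (f := fun x => (e.onPoints x).1) _
    (Subtype.val_injective.comp e.onPoints.injective)]
  congr 1
  ext x
  constructor
  · rintro ⟨hxA, hxb⟩
    exact ⟨e.onPoints.symm ⟨x, hxb⟩, by simpa using hxA, by simp⟩
  · rintro ⟨y, hy, rfl⟩
    exact ⟨hy, (e.onPoints y).2⟩

variable (hn : 2 ≤ n) (e : (affDesign (n - 1) n F).Iso (D.residual b))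

/-- The block of `D` that extends the affine hyperplane `f v = a`. -/
noncomputable def extBlock (f : Module.Dual F (Fin n → F)) (hf : f ≠ 0) (a : F) : B :=
  (e.onBlocks (affHyp (by omega) f hf a)).1

theorem extBlock_ne (f : Module.Dual F (Fin n → F)) (hf : f ≠ 0) (a : F) :
    extBlock hn e f hf a ≠ b := (e.onBlocks _).2

theorem apply_mem_extBlock (f : Module.Dual F (Fin n → F)) (hf : f ≠ 0) (a : F)
    (v : Fin n → F) : (e.onPoints v).1 ∈ D.block (extBlock hn e f hf a) ↔ f v = a :=
  (e.apply_mem_block_iff v _).trans (mem_affHyp _ hf a v)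

theorem extBlock_smul (f : Module.Dual F (Fin n → F)) (hf : f ≠ 0) (c : F) (hcf : c • f ≠ 0) :
    extBlock hn e (c • f) hcf 0 = extBlock hn e f hf 0 := by
  have hc : c ≠ 0 := fun hc => hcf (by rw [hc, zero_smul])
  unfold extBlock
  congr 2
  apply affHyp_eq_of_forall_mem_iff
  intro v
  refine (mem_affHyp _ hcf 0 v).trans ?_
  simp [hc]

theorem exists_eq_extBlock (c : B) (hc : c ≠ b) :
    ∃ f, ∃ hf : f ≠ 0, ∃ a, c = extBlock hn e f hf a := by
  obtain ⟨f, hf, a, h⟩ := exists_eq_affHyp (by omega) (e.onBlocks.symm ⟨c, hc⟩)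
  refine ⟨f, hf, a, ?_⟩
  rw [extBlock, ← h, Equiv.apply_symm_apply]

theorem ncard_mem_submodule [Finite F] (W : Submodule F (Fin n → F)) :
    {v | v ∈ W}.ncard = Nat.card F ^ Module.finrank F W := by
  rw [← Module.natCard_eq_pow_finrank (K := F), ← Nat.card_coe_set_eq]
  rfl

theorem ncard_extBlock_diff [Finite F] (f : Module.Dual F (Fin n → F)) (hf : f ≠ 0) :
    (D.block (extBlock hn e f hf 0) \ D.block b).ncard = Nat.card F ^ (n - 1) := by
  rw [e.ncard_diff]
  simp only [apply_mem_extBlock]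
  have h := ncard_mem_submodule (LinearMap.ker f)
  have h2 := Module.Dual.finrank_ker_add_one_of_ne_zero hf
  rw [Module.finrank_fin_fun] at h2
  rw [show Module.finrank F (LinearMap.ker f) = n - 1 by omega] at h
  simpa using h

/-- If two members had the same zero set, it would be the base of the pencil, which has codimension
2. -/
theorem extBlock_pencil_ne {f g : Module.Dual F (Fin n → F)} (hfg : LinearIndependent F ![f, g])
    {i j : Option F} (hij : i ≠ j) :
    extBlock hn e _ (pencil_ne_zero hfg i) 0 ≠ extBlock hn e _ (pencil_ne_zero hfg j) 0 := by
  intro h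
  have h1 : ∀ v, pencil f g i v = 0 ↔ pencil f g j v = 0 := fun v => by
    rw [← apply_mem_extBlock hn e _ (pencil_ne_zero hfg i), h, apply_mem_extBlock]
  have h2 : LinearMap.ker (pencil f g i) = LinearMap.ker f ⊓ LinearMap.ker g := by
    ext v
    rw [Submodule.mem_inf, LinearMap.mem_ker, LinearMap.mem_ker, LinearMap.mem_ker,
      ← pencil_eq_zero_and (f v) (g v) hij, ← pencil_apply, ← pencil_apply, ← h1, and_self]
  have h3 := Module.Dual.finrank_ker_add_one_of_ne_zero (pencil_ne_zero hfg i)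
  have h4 := finrank_ker_inf_ker hfg
  rw [h2] at h3
  omega

/-! ### Parameters and the pencil dichotomy -/

section Params

variable [Finite P] [Finite B] {w k l : ℕ} (hD : D.IsSymmetricDesign w k l)
include hn e hD

/-- An extended hyperplane has l points on `b` and q^(n-1) affine points. -/
theorem block_size_eq [Finite F] : k = l + Nat.card F ^ (n - 1) := by
  obtain ⟨f, hf⟩ : ∃ f : Module.Dual F (Fin n → F), f ≠ 0 := by
    refine ⟨LinearMap.proj ⟨0, by omega⟩, fun h => ?_⟩
    have := LinearMap.congr_fun h 1
    simp at this
  have := Fintype.ofFinite P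
  have := Fintype.ofFinite B
  rw [← ncard_extBlock_diff hn e f hf, ← hD.ncard_inter (extBlock_ne hn e f hf 0),
    Set.ncard_inter_add_ncard_sdiff_eq_ncard, hD.card_block]

omit hn in
theorem num_points_eq [Finite F] : w = k + Nat.card F ^ n := by
  have h := Set.ncard_inter_add_ncard_sdiff_eq_ncard (Set.univ : Set P) (D.block b)
  rw [Set.univ_inter, hD.card_block, Set.ncard_univ, hD.card_points, e.ncard_diff] at h
  have huniv : {x | (e.onPoints x).1 ∈ (Set.univ : Set P)} = Set.univ := by ext; simp
  rw [← h, huniv, Set.ncard_univ, Module.natCard_eq_pow_finrank (K := F), Module.finrank_fin_fun]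

theorem index_lt_block_size [Finite F] : l < k := by
  have h1 := block_size_eq hn e hD
  have : 0 < Nat.card F ^ (n - 1) := pow_pos Nat.card_pos _
  omega

/-- Substitute the sizes into k(k-1) = l(w-1) and cancel q^(n-1). With a factor q split off, the
relations show k ≡ l ≡ 1 mod p. -/
theorem param_relations [Finite F] :
    (k : ℤ) = l + Nat.card F * (Nat.card F : ℤ) ^ (n - 2) ∧
      (l : ℤ) * (Nat.card F - 1) = Nat.card F * (Nat.card F : ℤ) ^ (n - 2) - 1 := by
  have := Fintype.ofFinite P
  have := Fintype.ofFinite B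
  have h1 := block_size_eq hn e hD
  have h2 := num_points_eq e hD
  have h3 := hD.param_eq
  obtain ⟨m, rfl⟩ := Nat.exists_eq_add_of_le' hn
  rw [show m + 2 - 1 = m + 1 by omega] at h1
  rw [show m + 2 - 2 = m by omega]
  have hq : (0 : ℤ) < Nat.card F := by exact_mod_cast Nat.card_pos
  have h1' : (k : ℤ) = l + Nat.card F * (Nat.card F : ℤ) ^ m := by
    rw [h1]; push_cast; ring
  have h2' : (w : ℤ) = k + Nat.card F ^ 2 * (Nat.card F : ℤ) ^ m := by
    rw [h2]; push_cast; ring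
  have hM : (Nat.card F * (Nat.card F : ℤ) ^ m : ℤ) ≠ 0 := by positivity
  refine ⟨h1', mul_left_cancel₀ hM ?_⟩
  rw [h2', h1'] at h3
  linear_combination -h3

/-- Parallel hyperplanes have the same points at infinity. -/
theorem mem_extBlock_iff_zero {x : P} (hx : x ∈ D.block b) (f : Module.Dual F (Fin n → F))
    (hf : f ≠ 0) (a : F) :
    x ∈ D.block (extBlock hn e f hf a) ↔ x ∈ D.block (extBlock hn e f hf 0) := by
  have := Fintype.ofFinite P
  have := Fintype.ofFinite B
  have key : ∀ a a', x ∈ D.block (extBlock hn e f hf a) →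
      x ∈ D.block (extBlock hn e f hf a') := by
    intro a a' hxa
    by_cases haa : a = a'
    · rwa [← haa]
    have hdisj : ∀ v, f v = a → f v ≠ a' := fun v h h' => haa (h.symm.trans h')
    have hne : extBlock hn e f hf a ≠ extBlock hn e f hf a' := by
      intro h
      obtain ⟨v, hv⟩ := LinearMap.surjective hf a
      have h1 := (apply_mem_extBlock hn e f hf a v).2 hv
      rw [h, apply_mem_extBlock] at h1
      exact hdisj v hv h1
    -- Parallel hyperplanes are disjoint off `b`, so the l common points of their extensions lie on
    -- `b` and exhaust the l points where either meets `b`.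
    have hsub : D.block (extBlock hn e f hf a) ∩ D.block (extBlock hn e f hf a') ⊆
        D.block (extBlock hn e f hf a) ∩ D.block b := by
      rintro y ⟨hy, hy'⟩
      refine ⟨hy, ?_⟩
      by_contra hyb
      obtain ⟨v, hv⟩ := e.onPoints.surjective ⟨y, hyb⟩
      have hv : (e.onPoints v).1 = y := by rw [hv]
      rw [← hv, apply_mem_extBlock] at hy hy'
      exact hdisj v hy hy'
    have := Set.eq_of_subset_of_ncard_le hsub
      (by rw [hD.ncard_inter hne, hD.ncard_inter (extBlock_ne hn e f hf a)])
    exact (this.symm.subset ⟨hxa, hx⟩).2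
  exact ⟨key _ _, key _ _⟩

/-- Of the l common points of the two blocks, the q^(n-2) points of the base of the pencil are
affine. -/
theorem sum_chi_pencil [Fintype P] [Finite F] {f g : Module.Dual F (Fin n → F)}
    (hfg : LinearIndependent F ![f, g]) {i j : Option F} (hij : i ≠ j) :
    ∑ x, D.chi b x * (D.chi (extBlock hn e _ (pencil_ne_zero hfg i) 0) x *
      D.chi (extBlock hn e _ (pencil_ne_zero hfg j) 0) x) =
        l - (Nat.card F : ℤ) ^ (n - 2) := by
  classical
  have := Fintype.ofFinite B
  have h1 := hD.ncard_inter (extBlock_pencil_ne hn e hfg hij)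
  set c := extBlock hn e _ (pencil_ne_zero hfg i) 0 with hc
  set d := extBlock hn e _ (pencil_ne_zero hfg j) 0 with hd
  have h2 : ((D.block c ∩ D.block d) \ D.block b).ncard = Nat.card F ^ (n - 2) := by
    rw [e.ncard_diff]
    simp only [Set.mem_inter_iff, hc, hd, apply_mem_extBlock, pencil_apply,
      pencil_eq_zero_and _ _ hij]
    have h := ncard_mem_submodule (LinearMap.ker f ⊓ LinearMap.ker g)
    have h2 := finrank_ker_inf_ker hfg
    rw [Module.finrank_fin_fun] at h2
    rw [show n - 2 = Module.finrank F (LinearMap.ker f ⊓ LinearMap.ker g :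
      Submodule F (Fin n → F)) by omega]
    simpa using h
  have h3 := Set.ncard_inter_add_ncard_sdiff_eq_ncard (D.block c ∩ D.block d) (D.block b)
  have h4 : ∑ x, D.chi b x * (D.chi c x * D.chi d x) =
      ((D.block c ∩ D.block d) ∩ D.block b).ncard := by
    simp only [chi, ← ite_and, mul_ite, mul_one, mul_zero, Finset.sum_boole]
    rw [Set.ncard_eq_toFinset_card']
    congr 2
    ext; simp; tauto
  rw [h4, ← h1, ← h3, h2]
  push_cast
  ring

/-- Every point at infinity lies on exactly one or on all hyperplanes of a pencil. -/
theorem sum_pencil_chi_eq [Fintype F] {p : ℕ} [Fact p.Prime]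
    (hF : (Fintype.card F : ZMod p) = 0) (hLE : D.LinearlyEmbeddable p b)
    {f g : Module.Dual F (Fin n → F)} (hfg : LinearIndependent F ![f, g]) {x : P}
    (hx : x ∈ D.block b) :
    ∑ i, D.chi (extBlock hn e _ (pencil_ne_zero hfg i) 0) x = 1 ∨
      ∑ i, D.chi (extBlock hn e _ (pencil_ne_zero hfg i) 0) x = Fintype.card F + 1 := by
  classical
  have := Fintype.ofFinite P
  have := Fintype.ofFinite B
  obtain ⟨hkl, hl⟩ := param_relations hn e hD
  rw [Nat.card_eq_fintype_card] at hkl hl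
  set c : Option F → B := fun i => extBlock hn e _ (pencil_ne_zero hfg i) 0 with hc
  set N : P → ℤ := fun y => ∑ i, D.chi (c i) y with hN
  change N x = 1 ∨ N x = _
  have hf : f ≠ 0 := pencil_ne_zero hfg none
  -- the codeword supported on `b`
  obtain ⟨α, hα⟩ : ∃ α : ZMod p, ∀ y ∈ D.block b, (N y : ZMod p) = α := by
    -- An affine point lies on 1 or q+1 members of the pencil and on one hyperplane parallel to f =
    -- 0, so the difference vanishes there mod p.
    obtain ⟨α, hα⟩ := (linearlyEmbeddable_iff D ⟨x, hx⟩).1 hLE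
      (∑ i, (D.incMatrix (ZMod p)).col (c i) -
        ∑ a : F, (D.incMatrix (ZMod p)).col (extBlock hn e f hf a))
      (sub_mem (sum_mem fun i _ => D.col_mem_code _) (sum_mem fun a _ => D.col_mem_code _)) (by
        intro y hy
        obtain ⟨v, hv⟩ := e.onPoints.surjective ⟨y, hy⟩
        have hv : (e.onPoints v).1 = y := by rw [hv]
        have h1 : ∀ i, D.incMatrix (ZMod p) y (c i) =
            if pencil (f v) (g v) i = 0 then 1 else 0 := fun i => by
          simp only [← pencil_apply, ← apply_mem_extBlock hn e _ (pencil_ne_zero hfg i), hv]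
          split_ifs with h
          exacts [incMatrix_apply_of_mem h, incMatrix_apply_of_notMem h]
        have h2 : ∀ a, D.incMatrix (ZMod p) y (extBlock hn e f hf a) =
            if f v = a then 1 else 0 := fun a => by
          simp only [← apply_mem_extBlock hn e f hf a, hv]
          split_ifs with h
          exacts [incMatrix_apply_of_mem h, incMatrix_apply_of_notMem h]
        simp [Matrix.col_apply, h1, h2, -Fintype.sum_option, sum_pencil hF])
    refine ⟨α, fun y hy => ?_⟩
    rw [← hα y hy]
    -- On `b` the parallel class contributes q equal terms, hence 0 mod p, and N alone remains.
    have h2 : ∀ a, D.incMatrix (ZMod p) y (extBlock hn e f hf a) =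
        D.incMatrix (ZMod p) y (extBlock hn e f hf 0) := fun a => by
      have := mem_extBlock_iff_zero hn e hD hy f hf a
      by_cases h : y ∈ D.block (extBlock hn e f hf 0)
      · rw [incMatrix_apply_of_mem h, incMatrix_apply_of_mem (this.2 h)]
      · rw [incMatrix_apply_of_notMem h, incMatrix_apply_of_notMem (mt this.1 h)]
    simp [Matrix.col_apply, h2, hN, incMatrix_eq_chi, hF, -Fintype.sum_option]
  -- first and second moments
  have m0 : ∑ y, D.chi b y = k := hD.toIsDesign.sum_chi_block b
  have mi : ∀ i, ∑ y, D.chi b y * D.chi (c i) y = l := fun i => by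
    rw [sum_chi_mul_chi, hD.ncard_inter (extBlock_ne hn e _ _ _).symm]
  have m1 : ∑ y, D.chi b y * N y = (Fintype.card F + 1) * l := by
    simp only [hN, Finset.mul_sum]
    rw [Finset.sum_comm]
    simp only [mi, Finset.sum_const, Finset.card_univ, Fintype.card_option, nsmul_eq_mul]
    push_cast
    ring
  have m2 : ∑ y, D.chi b y * (N y * N y) = (Fintype.card F + 1) *
      (l + Fintype.card F * (l - (Fintype.card F : ℤ) ^ (n - 2))) := by
    have h1 : ∀ y, D.chi b y * (N y * N y) =
        ∑ i, ∑ j, D.chi b y * (D.chi (c i) y * D.chi (c j) y) := fun y => by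
      simp only [hN]
      rw [Finset.sum_mul_sum, Finset.mul_sum]
      simp only [Finset.mul_sum]
    simp only [h1]
    rw [Finset.sum_comm]
    have h2 : ∀ i, ∑ y, ∑ j, D.chi b y * (D.chi (c i) y * D.chi (c j) y) =
        l + Fintype.card F * (l - (Fintype.card F : ℤ) ^ (n - 2)) := by
      intro i
      rw [Finset.sum_comm, ← Finset.add_sum_erase _ _ (Finset.mem_univ i)]
      congr 1
      · simp only [chi_mul_self, mi]
      · rw [Finset.sum_congr rfl fun j hj =>
          sum_chi_pencil hn e hD hfg (Finset.ne_of_mem_erase hj).symm,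
          Finset.sum_const, Finset.card_erase_of_mem (Finset.mem_univ i), Finset.card_univ,
          Fintype.card_option, nsmul_eq_mul, Nat.add_sub_cancel, Nat.card_eq_fintype_card]
    simp only [h2, Finset.sum_const, Finset.card_univ, Fintype.card_option, nsmul_eq_mul]
    push_cast
    ring
  -- Summing N over `b` gives (q+1) l = k α mod p, where q ≡ 0 and k ≡ l ≡ 1.
  have hα1 : α = 1 := by
    have h1 : ((∑ y, D.chi b y * N y : ℤ) : ZMod p) = k * α := by
      rw [← Int.cast_natCast k, ← m0]
      push_cast
      rw [Finset.sum_mul]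
      refine Finset.sum_congr rfl fun y _ => ?_
      by_cases hy : y ∈ D.block b
      · rw [← hα y hy]
      · rw [chi_of_notMem hy]; simp
    rw [m1] at h1
    have h2 := congrArg (Int.cast : ℤ → ZMod p) hkl
    have h3 := congrArg (Int.cast : ℤ → ZMod p) hl
    push_cast at h1 h2 h3
    rw [hF] at h1 h2 h3
    have hl1 : (l : ZMod p) = 1 := by linear_combination -h3
    rw [h2, hl1] at h1
    linear_combination -h1
  have hpos : ∀ y ∈ D.block b, 1 ≤ N y := by
    intro y hy
    have h0 : 0 ≤ N y := Finset.sum_nonneg fun i _ => by unfold chi; split_ifs <;> simp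
    have h1 : N y ≠ 0 := by
      intro h
      have := hα y hy
      rw [h, hα1, Int.cast_zero] at this
      exact zero_ne_one this
    omega
  have hle : ∀ y, N y ≤ Fintype.card F + 1 := by
    intro y
    have : N y ≤ ∑ i : Option F, (1 : ℤ) :=
      Finset.sum_le_sum fun i _ => by unfold chi; split_ifs <;> simp
    simpa [-Fintype.sum_option] using this
  -- The quadratic is chosen to be nonnegative for 1 ≤ N ≤ q+1, with equality only at the ends; the
  -- moments make its sum zero.
  have hsum : ∑ y, D.chi b y * ((N y - 1) * (Fintype.card F + 1 - N y)) = 0 := by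
    have h1 : ∀ y, D.chi b y * ((N y - 1) * (Fintype.card F + 1 - N y)) =
        (Fintype.card F + 2) * (D.chi b y * N y) - D.chi b y * (N y * N y) -
          (Fintype.card F + 1) * D.chi b y := fun y => by ring
    simp only [h1, Finset.sum_sub_distrib, ← Finset.mul_sum, m0, m1, m2]
    rw [hkl]
    ring
  have h0 := (Finset.sum_eq_zero_iff_of_nonneg fun y _ => by
    by_cases hy : y ∈ D.block b
    · rw [chi_of_mem hy, one_mul]
      exact mul_nonneg (by linarith [hpos y hy]) (by linarith [hle y])
    · rw [chi_of_notMem hy, zero_mul]).1 hsum x (Finset.mem_univ x)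
  rw [chi_of_mem hx, one_mul, mul_eq_zero] at h0
  rcases h0 with h0 | h0
  · left; linarith
  · right; linarith

end Params

end Embedding

end IncidenceStructure

namespace IncidenceStructure

/-! ### Points of the block as points at infinity -/

section Infinity

variable {P B F : Type*} [Field F] [Finite F] [Finite P] [Finite B] {n : ℕ}
  {D : IncidenceStructure P B} {b : B} (hn : 2 ≤ n)
  (e : (affDesign (n - 1) n F).Iso (D.residual b)) {w k l : ℕ}
  (hD : D.IsSymmetricDesign w k l) {p : ℕ} [Fact p.Prime] (hF : (Nat.card F : ZMod p) = 0)
  (hLE : D.LinearlyEmbeddable p b)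

include hD hF hLE in
theorem exists_mem_pencil {f g : Module.Dual F (Fin n → F)} (hfg : LinearIndependent F ![f, g])
    {x : P} (hx : x ∈ D.block b) :
    ∃ i, x ∈ D.block (extBlock hn e _ (pencil_ne_zero hfg i) 0) := by
  have := Fintype.ofFinite F
  rw [Nat.card_eq_fintype_card] at hF
  by_contra! hno
  have h := sum_pencil_chi_eq hn e hD hF hLE hfg hx
  rw [Finset.sum_eq_zero fun i _ => chi_of_notMem (hno i)] at h
  rcases h with h | h <;> omega

include hD hF hLE in
-- Two incidences exclude N = 1, so N = q+1 and all members pass through x.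
theorem mem_pencil_of_mem_of_mem {f g : Module.Dual F (Fin n → F)}
    (hfg : LinearIndependent F ![f, g]) {x : P} (hx : x ∈ D.block b) {i j : Option F}
    (hij : i ≠ j) (hi : x ∈ D.block (extBlock hn e _ (pencil_ne_zero hfg i) 0))
    (hj : x ∈ D.block (extBlock hn e _ (pencil_ne_zero hfg j) 0)) (m : Option F) :
    x ∈ D.block (extBlock hn e _ (pencil_ne_zero hfg m) 0) := by
  classical
  have := Fintype.ofFinite F
  rw [Nat.card_eq_fintype_card] at hF
  have h := sum_pencil_chi_eq hn e hD hF hLE hfg hx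
  set χ : Option F → ℤ := fun i => D.chi (extBlock hn e _ (pencil_ne_zero hfg i) 0) x with hχ
  have h0 : ∀ i, 0 ≤ χ i := fun i => by simp only [hχ, chi]; split_ifs <;> simp
  have h1 : ∀ i, χ i ≤ 1 := fun i => by simp only [hχ, chi]; split_ifs <;> simp
  have hχi : χ i = 1 := chi_of_mem hi
  have hχj : χ j = 1 := chi_of_mem hj
  change ∑ i, χ i = 1 ∨ ∑ i, χ i = _ at h
  have h2 := Finset.add_le_sum (f := χ) (s := Finset.univ) (fun i _ => h0 i)
    (Finset.mem_univ i) (Finset.mem_univ j) hij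
  have h3 : ∑ i, (1 - χ i) = 0 := by
    rw [Finset.sum_sub_distrib, h.resolve_left (by omega)]
    simp [-Fintype.sum_option]
  have h4 := (Finset.sum_eq_zero_iff_of_nonneg fun i _ => sub_nonneg.2 (h1 i)).1 h3 m
    (Finset.mem_univ m)
  by_contra hm
  have : χ m = 0 := chi_of_notMem hm
  omega

/-- The functionals whose kernels, if hyperplanes, contain a given point at infinity. -/
def functionalsThrough (x : P) : Set (Module.Dual F (Fin n → F)) :=
  {f | ∀ hf : f ≠ 0, x ∈ D.block (extBlock hn e f hf 0)}

omit [Finite F] [Finite P] [Finite B] in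
theorem mem_functionalsThrough {x : P} {f : Module.Dual F (Fin n → F)} (hf : f ≠ 0) :
    f ∈ functionalsThrough hn e x ↔ x ∈ D.block (extBlock hn e f hf 0) :=
  ⟨fun h => h hf, fun h _ => h⟩

omit [Finite F] [Finite P] [Finite B] in
theorem smul_mem_functionalsThrough {x : P} {f : Module.Dual F (Fin n → F)}
    (hf : f ∈ functionalsThrough hn e x) (c : F) : c • f ∈ functionalsThrough hn e x := by
  intro hcf
  rw [extBlock_smul hn e f (right_ne_zero_of_smul hcf)]
  exact hf _

include hD hF hLE in
-- For independent f and g, these are the members `none` and `some 0` of their pencil, and f + g is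
-- the member `some 1`. Otherwise one is a multiple of the other.
theorem add_mem_functionalsThrough {x : P} (hx : x ∈ D.block b)
    {f g : Module.Dual F (Fin n → F)} (hf : f ∈ functionalsThrough hn e x)
    (hg : g ∈ functionalsThrough hn e x) : f + g ∈ functionalsThrough hn e x := by
  by_cases hli : LinearIndependent F ![f, g]
  · have hg' : pencil f g (some (0 : F)) ∈ functionalsThrough hn e x := by simpa [pencil] using hg
    have h := mem_pencil_of_mem_of_mem hn e hD hF hLE hli hx (i := none) (j := some (0 : F)) (by simp)
      (hf _) (hg' _) (some 1)
    rw [← mem_functionalsThrough] at h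
    simpa [pencil, add_comm] using h
  · by_cases hf0 : f = 0
    · rwa [hf0, zero_add]
    · rw [LinearIndependent.pair_iff' hf0] at hli
      push Not at hli
      obtain ⟨c, rfl⟩ := hli
      have := smul_mem_functionalsThrough hn e hf (1 + c)
      rwa [add_smul, one_smul] at this

/-- The functionals whose kernels contain a given point at infinity, as a subspace. -/
def submoduleThrough {x : P} (hx : x ∈ D.block b) : Submodule F (Module.Dual F (Fin n → F)) where
  carrier := functionalsThrough hn e x
  zero_mem' h := absurd rfl h
  smul_mem' c _ hf := smul_mem_functionalsThrough hn e hf c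
  add_mem' := add_mem_functionalsThrough hn e hD hF hLE hx

include hD in
-- A block through y avoiding x cannot be `b`, so it extends a hyperplane; parallelism moves the
-- condition at x to level 0.
theorem exists_separating_functional {x y : P} (hx : x ∈ D.block b) (hxy : x ≠ y) :
    ∃ f, ∃ hf : f ≠ 0, ∃ a, x ∉ D.block (extBlock hn e f hf 0) ∧
      y ∈ D.block (extBlock hn e f hf a) := by
  have := Fintype.ofFinite P
  have := Fintype.ofFinite B
  obtain ⟨c, hxc, hyc⟩ := hD.exists_block (index_lt_block_size hn e hD) hxy
  obtain ⟨f, hf, a, rfl⟩ := exists_eq_extBlock hn e c (fun h => hxc (h ▸ hx))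
  exact ⟨f, hf, a, mt (mem_extBlock_iff_zero hn e hD hx f hf a).2 hxc, hyc⟩

/-- Separating x from an affine point yields some f outside the subspace K. For any g independent of
f, the pencil of f and g has a member in K, which is not f, so K and f span the dual. -/
theorem finrank_submoduleThrough {x : P} (hx : x ∈ D.block b) :
    Module.finrank F (submoduleThrough hn e hD hF hLE hx) + 1 = n := by
  set K := submoduleThrough hn e hD hF hLE hx with hK
  have hfin : Module.finrank F (Module.Dual F (Fin n → F)) = n := by
    rw [Subspace.dual_finrank_eq, Module.finrank_fin_fun]
  obtain ⟨f, hf, -, hxf, -⟩ := exists_separating_functional hn e hD hx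
    (y := (e.onPoints 0).1) (fun h => (e.onPoints 0).2 (h ▸ hx))
  have hfK : f ∉ K := fun h => hxf ((mem_functionalsThrough hn e hf).1 h)
  have hsup : K ⊔ Submodule.span F {f} = ⊤ := by
    rw [eq_top_iff]
    intro g _
    by_cases hli : LinearIndependent F ![f, g]
    · obtain ⟨i, hi⟩ := exists_mem_pencil hn e hD hF hLE hli hx
      rw [← mem_functionalsThrough] at hi
      rcases i with _ | c
      · exact absurd hi hfK
      · have h1 : g = (g + c • f) + (-c) • f := by module
        rw [h1]
        exact Submodule.add_mem_sup hi
          (Submodule.smul_mem _ _ (Submodule.mem_span_singleton_self f))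
    · rw [LinearIndependent.pair_iff' hf] at hli
      push Not at hli
      obtain ⟨c, rfl⟩ := hli
      exact Submodule.mem_sup_right
        (Submodule.smul_mem _ _ (Submodule.mem_span_singleton_self f))
  have h1 := Submodule.finrank_add_le_finrank_add_finrank K (Submodule.span F {f})
  rw [hsup, finrank_top, hfin, finrank_span_singleton hf] at h1
  have h2 := Submodule.finrank_lt (s := K) (fun h => hfK (h ▸ Submodule.mem_top))
  omega

/-- The point at infinity of the affine geometry that corresponds to a point of the block `b`. -/
noncomputable def pointAtInfinity (x : {x // x ∈ D.block b}) : Projectivization F (Fin n → F) :=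
  Projectivization.mk'' (submoduleThrough hn e hD hF hLE x.2).dualCoannihilator (by
    have h1 := Subspace.finrank_add_finrank_dualCoannihilator_eq
      (submoduleThrough hn e hD hF hLE x.2)
    have h2 := finrank_submoduleThrough hn e hD hF hLE x.2
    rw [Module.finrank_fin_fun] at h1
    omega)

theorem mem_extBlock_iff_pointAtInfinity_le (x : {x // x ∈ D.block b})
    (f : Module.Dual F (Fin n → F)) (hf : f ≠ 0) (a : F) :
    x.1 ∈ D.block (extBlock hn e f hf a) ↔
      (pointAtInfinity hn e hD hF hLE x).submodule ≤ LinearMap.ker f := by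
  rw [mem_extBlock_iff_zero hn e hD x.2, ← mem_functionalsThrough hn e hf, pointAtInfinity,
    Projectivization.submodule_mk'']
  change f ∈ submoduleThrough hn e hD hF hLE x.2 ↔ _
  conv_lhs => rw [← Subspace.dualCoannihilator_dualAnnihilator_eq
    (W := submoduleThrough hn e hD hF hLE x.2), Submodule.mem_dualAnnihilator]
  rfl

/-- Separating functionals give injectivity, and the parameter relations give k = (q^n-1)/(q-1), the
number of points at infinity. -/
theorem pointAtInfinity_bijective : Function.Bijective (pointAtInfinity hn e hD hF hLE) := by
  refine Function.Injective.bijective_of_nat_card_le (fun x y hxy => ?_) ?_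
  · by_contra hne
    obtain ⟨f, hf, a, h1, h2⟩ := exists_separating_functional hn e hD x.2
      (y := y.1) (fun h => hne (Subtype.ext h))
    rw [mem_extBlock_iff_pointAtInfinity_le hn e hD hF hLE] at h1 h2
    rw [hxy] at h1
    exact h1 h2
  · have hk : Nat.card {x // x ∈ D.block b} = k := by
      rw [← hD.card_block b, ← Nat.card_coe_set_eq]
    rw [hk]
    have h1 := Projectivization.card' F (Fin n → F)
    rw [Module.natCard_eq_pow_finrank (K := F), Module.finrank_fin_fun] at h1
    obtain ⟨h2, h3⟩ := param_relations hn e hD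
    have hq : 1 < Nat.card F := Finite.one_lt_card
    obtain ⟨m, rfl⟩ := Nat.exists_eq_add_of_le' hn
    rw [show m + 2 - 2 = m by omega] at h2 h3
    have h4 := congrArg (Nat.cast : ℕ → ℤ) h1
    push_cast [Nat.cast_sub hq.le] at h4
    have h5 : (Nat.card (Projectivization F (Fin (m + 2) → F)) : ℤ) = k := by
      apply mul_right_cancel₀ (b := (Nat.card F : ℤ) - 1) (by omega)
      rw [h2]
      linear_combination -h4 - h3
    exact (Nat.cast_injective h5).le

include hn hD hF hLE in
/-- The points of the block `b` are the points at infinity of the affine geometry. -/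
theorem exists_equiv_points_at_infinity :
    ∃ π : {x // x ∈ D.block b} ≃ Projectivization F (Fin n → F), ∀ x S,
      x.1 ∈ D.block (e.onBlocks S).1 ↔ (π x).submodule ≤ S.1.direction := by
  refine ⟨Equiv.ofBijective _ (pointAtInfinity_bijective hn e hD hF hLE), fun x S => ?_⟩
  obtain ⟨f, hf, a, rfl⟩ := exists_eq_affHyp (one_le_two.trans hn) S
  rw [direction_affHyp]
  exact mem_extBlock_iff_pointAtInfinity_le hn e hD hF hLE x f hf a

end Infinity

/-! ### Gluing isomorphisms of residuals -/

section Glue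

variable {P B P' B' X Y Z : Type*} {D : IncidenceStructure P B} {D' : IncidenceStructure P' B'}
  {E : IncidenceStructure X Y} {b : B} {b' : B'}

/-- Isomorphic residual designs and compatible bijections between the points of the deleted
blocks yield an isomorphism. -/
theorem exists_iso_of_residual (e : E.Iso (D.residual b)) (e' : E.Iso (D'.residual b'))
    (π : {x // x ∈ D.block b} ≃ Z) (π' : {x // x ∈ D'.block b'} ≃ Z)
    (h : ∀ x S z, π x = z → (x.1 ∈ D.block (e.onBlocks S).1 ↔
      (π'.symm z).1 ∈ D'.block (e'.onBlocks S).1)) :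
    ∃ φ : D.Iso D', φ.onBlocks b = b' ∧
      (∀ x, φ.onPoints (e.onPoints x).1 = (e'.onPoints x).1) ∧
      (∀ c, φ.onBlocks (e.onBlocks c).1 = (e'.onBlocks c).1) := by
  classical
  let ρ : {x // x ∈ D.block b} ≃ {x // x ∈ D'.block b'} := π.trans π'.symm
  let σ : {x // x ∉ D.block b} ≃ {x // x ∉ D'.block b'} := e.onPoints.symm.trans e'.onPoints
  let τ : {c // ¬ c = b} ≃ {c // ¬ c = b'} := e.onBlocks.symm.trans e'.onBlocks
  let τ₀ : {c // c = b} ≃ {c // c = b'} :=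
    ⟨fun _ => ⟨b', rfl⟩, fun _ => ⟨b, rfl⟩, fun c => Subtype.ext c.2.symm,
      fun c => Subtype.ext c.2.symm⟩
  let φP : P ≃ P' := (Equiv.sumCompl (· ∈ D.block b)).symm.trans
    ((Equiv.sumCongr ρ σ).trans (Equiv.sumCompl (· ∈ D'.block b')))
  let φB : B ≃ B' := (Equiv.sumCompl (· = b)).symm.trans
    ((Equiv.sumCongr τ₀ τ).trans (Equiv.sumCompl (· = b')))
  have hp1 : ∀ x (hx : x ∈ D.block b), φP x = ρ ⟨x, hx⟩ := fun x hx => by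
    simp [φP, Equiv.sumCompl_symm_apply_of_pos (p := (· ∈ D.block b)) hx]
  have hp2 : ∀ x, φP (e.onPoints x).1 = (e'.onPoints x).1 := fun x => by
    simp [φP, Equiv.sumCompl_symm_apply_of_neg (p := (· ∈ D.block b)) (e.onPoints x).2, σ]
  have hb1 : φB b = b' := by
    simp [φB, Equiv.sumCompl_symm_apply_of_pos (p := (· = b)) rfl, τ₀]
  have hb2 : ∀ c, φB (e.onBlocks c).1 = (e'.onBlocks c).1 := fun c => by
    simp [φB, Equiv.sumCompl_symm_apply_of_neg (p := (· = b)) (e.onBlocks c).2, τ]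
  refine ⟨⟨φP, φB, fun x c => ?_⟩, hb1, hp2, hb2⟩
  by_cases hc : c = b
  · rw [hc, hb1]
    by_cases hx : x ∈ D.block b
    · rw [hp1 x hx]
      exact ⟨fun _ => (ρ _).2, fun _ => hx⟩
    · obtain ⟨y, hy⟩ := e.onPoints.surjective ⟨x, hx⟩
      have hy : (e.onPoints y).1 = x := by rw [hy]
      rw [← hy, hp2]
      exact ⟨fun h => absurd h (e.onPoints y).2, fun h => absurd h (e'.onPoints y).2⟩
  · obtain ⟨S, hS⟩ := e.onBlocks.surjective ⟨c, hc⟩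
    have hS : (e.onBlocks S).1 = c := by rw [hS]
    rw [← hS, hb2]
    by_cases hx : x ∈ D.block b
    · rw [hp1 x hx]
      exact h ⟨x, hx⟩ S _ rfl
    · obtain ⟨y, hy⟩ := e.onPoints.surjective ⟨x, hx⟩
      have hy : (e.onPoints y).1 = x := by rw [hy]
      rw [← hy, hp2]
      exact (e.mem_iff y S).symm.trans (e'.mem_iff y S)

end Glue

end IncidenceStructure

theorem mainTheorem9 {p t q n : ℕ} (hp : p.Prime) (hq : q = p ^ t) (hn : 2 ≤ n)
    {F : Type*} [Field F] [Finite F] (hF : Nat.card F = q) :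
    -- `PG_{n-1}(n,q)` is a symmetric 2-design with the expected parameters
    (projDesign (n - 1) n F).IsSymmetricDesign
      ((q ^ (n + 1) - 1) / (q - 1)) ((q ^ n - 1) / (q - 1)) ((q ^ (n - 1) - 1) / (q - 1)) ∧
    -- `AG_{n-1}(n,q)` is its residual design for every block, and is linearly embeddable in it
    (∀ H : ProjSubspace (n - 1) n F,
      Nonempty ((affDesign (n - 1) n F).Iso ((projDesign (n - 1) n F).residual H)) ∧
      (projDesign (n - 1) n F).LinearlyEmbeddable p H) ∧
    -- every linear embedding of `AG_{n-1}(n,q)` as a residual design in a symmetric 2-design is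
    -- isomorphic to that one, by an isomorphism respecting the embedded copies
    (∀ (P B : Type*) [Finite P] [Finite B] (D : IncidenceStructure P B) (v k l : ℕ),
      D.IsSymmetricDesign v k l →
      ∀ b : B, D.LinearlyEmbeddable p b →
      ∀ (e : (affDesign (n - 1) n F).Iso (D.residual b))
        (H : ProjSubspace (n - 1) n F)
        (e₀ : (affDesign (n - 1) n F).Iso ((projDesign (n - 1) n F).residual H)),
      ∃ φ : D.Iso (projDesign (n - 1) n F),
        φ.onBlocks b = H ∧
        (∀ x, φ.onPoints (e.onPoints x).1 = (e₀.onPoints x).1) ∧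
        (∀ c, φ.onBlocks (e.onBlocks c).1 = (e₀.onBlocks c).1)) := by
  have : Fact p.Prime := ⟨hp⟩
  have hFp : (Nat.card F : ZMod p) = 0 := by
    -- A field has more than one element, which rules out q = p^0.
    have ht : t ≠ 0 := by
      rintro rfl
      have : 1 < Nat.card F := Finite.one_lt_card
      rw [hF, hq, pow_zero] at this
      exact lt_irrefl _ this
    rw [hF, hq, Nat.cast_pow, ZMod.natCast_self, zero_pow ht]
  subst hF
  have hsym := projDesign_isSymmetricDesign (F := F) hn
  have hPG := fun H => projDesign_linearlyEmbeddable (F := F) (n := n) hFp (by omega) H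
  refine ⟨hsym, fun H => ⟨nonempty_iso_residual_projDesign (by omega) H, hPG H⟩, ?_⟩
  intro P B _ _ D v k l hD b hLE e H e₀
  obtain ⟨π, hπ⟩ := IncidenceStructure.exists_equiv_points_at_infinity hn e hD hFp hLE
  -- PG is treated as one more linear embedding, so incidence at infinity is governed by directions
  -- in both designs.
  obtain ⟨π₀, hπ₀⟩ := IncidenceStructure.exists_equiv_points_at_infinity hn e₀ hsym hFp (hPG H)
  refine IncidenceStructure.exists_iso_of_residual e e₀ π π₀ ?_
  rintro x S _ rfl
  rw [hπ, hπ₀, Equiv.apply_symm_apply]
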